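/- Let $m\ge 2$ be an integer, let $p$ be a real number with $m<p\le 2m-2$, and let $\mathbb K=\mathbb R$ or $\mathbb C$. Let $(e_k)_{k\ge 1}$ be the canonical unit vectors of the sequence space $\ell_p=\ell_p(\mathbb N;\mathbb K)$. For every continuous $m$-linear form $T:\ell_p\times\cdots\times\ell_p\to\mathbb K$, put $$\|T\|=\sup\{|T(x_1,\dots,x_m)| : \|x_l\|_{\ell_p}\le 1 \text{ for } l=1,\dots,m\}.$$ Then, for every continuous $m$-linear form $T:\ell_p\times\cdots\times\ell_p\to\mathbb K$, every $i\in\{1,\dots,m\}$ and every positive integer $n$, $$\left(\sum_{j_i=1}^{n}\left(\sum_{\widehat{j_i}=1}^{n}\left|T(e_{j_1},\dots,e_{j_m})\right|^{\frac{p}{p-(m-1)}}\right)^{\frac{p-(m-1)}{p}\cdot\frac{p}{p-m}}\right)^{\frac{p-m}{p}}\le 2^{\frac{(m-1)(p-m+1)}{p}}\,\|T\|,$$ where, for fixed $j_i$, the sum over $\widehat{j_i}$ runs over all indices $j_l\in\{1,\dots,n\}$ with $l\ne i$. -/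

import Mathlib

/-! Put `N = m - 1` and `s = p / (p - N)`; the hypothesis `p ≤ 2m - 2` says `s ≥ 2`.

Sign averaging: random signs in every slot but `k` and matching phases in slot `k` turn the form
into an average of `ℓ_1` sums. The Kahane–Khinchine inequality with constant `√2`, iterated over `N`
slots, bounds the `ℓ_2` norm of an array by `2 ^ (N / 2)` times the first moment of its signed sums,
which also dominates every entry. Interpolation bounds the `ℓ_s` norm with constant `2 ^ (N / s)`.
Hence the `ℓ_1(ℓ_s)` norm, with any slot `k` outside, is at most `2 ^ (N / s) * ‖T‖`, even after
diagonal weights from the unit ball of `ℓ_p` (`sum_rpow_sum_weighted_le`).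

Choice of weights: they are `p`-th roots of the marginals of a probability array `q` built from the
coefficients, so that the slot `i` weight is already contained in `q`. Hölder on fibres and AM-GM
over the slots `k ≠ i` (`exists_one_le_sum_rpow_sum_mul_marginals`) give a `k` whose weighted norm
is at least the desired `ℓ_r(ℓ_s)` norm. -/

/-! ### Spectral gap on the discrete cube -/

section SignAverages

open Finset
open scoped BigOperators

/-- Changing the sign of one coordinate. -/
def flipSign {ι : Type*} [DecidableEq ι] (i : ι) (ε : ι → ℤˣ) : ι → ℤˣ :=
  Function.update ε i (-ε i)

theorem flipSign_involutive {ι : Type*} [DecidableEq ι] (i : ι) :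
    Function.Involutive (flipSign i) := by
  intro ε
  simp [flipSign]

theorem flipSign_zero_cons {n : ℕ} (u : ℤˣ) (x : Fin n → ℤˣ) :
    flipSign 0 (Fin.cons u x : Fin (n + 1) → ℤˣ) = Fin.cons (-u) x := by
  simp [flipSign]

theorem flipSign_succ_cons {n : ℕ} (u : ℤˣ) (x : Fin n → ℤˣ) (i : Fin n) :
    flipSign i.succ (Fin.cons u x : Fin (n + 1) → ℤˣ) = Fin.cons u (flipSign i x) := by
  simp [flipSign, Fin.cons_update]

theorem neg_cons {n : ℕ} (u : ℤˣ) (x : Fin n → ℤˣ) :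
    -(Fin.cons u x : Fin (n + 1) → ℤˣ) = Fin.cons (-u) (-x) := by
  ext j
  refine Fin.cases ?_ (fun j => ?_) j <;> simp

theorem expect_cons {n : ℕ} (F : (Fin (n + 1) → ℤˣ) → ℝ) :
    𝔼 ε, F ε = 𝔼 x : Fin n → ℤˣ, (F (Fin.cons 1 x) + F (Fin.cons (-1) x)) / 2 := by
  rw [← Fintype.expect_equiv (Fin.consEquiv fun _ => ℤˣ) (fun q => F (Fin.cons q.1 q.2)) F
    (fun _ => rfl), ← univ_product_univ, expect_product, expect_comm]
  refine expect_congr rfl fun x _ => ?_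
  rw [expect_eq_sum_div_card, UnitsInt.univ, sum_pair (by decide)]
  simp

theorem expect_neg {n : ℕ} (F : (Fin n → ℤˣ) → ℝ) : 𝔼 ε, F (-ε) = 𝔼 ε, F ε :=
  Fintype.expect_equiv (Equiv.neg _) _ _ fun _ => rfl

theorem expect_flipSign {n : ℕ} (i : Fin n) (F : (Fin n → ℤˣ) → ℝ) :
    𝔼 ε, F (flipSign i ε) = 𝔼 ε, F ε :=
  Fintype.expect_equiv (flipSign_involutive i).toPerm _ _ fun _ => rfl

/-- With `f = g + ε₀ h`, flipping a later sign acts on `g` and `h` separately, with cross terms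
cancelling over `ε₀`; flipping `ε₀` changes `f` by `2h` up to sign, whence `4 * 𝔼 h ^ 2`. -/
theorem expect_energy_cons {n : ℕ} (f : (Fin (n + 1) → ℤˣ) → ℝ) (g h : (Fin n → ℤˣ) → ℝ)
    (hg : ∀ x, g x = (f (Fin.cons 1 x) + f (Fin.cons (-1) x)) / 2)
    (hh : ∀ x, h x = (f (Fin.cons 1 x) - f (Fin.cons (-1) x)) / 2) :
    𝔼 ε, ∑ i, (f ε - f (flipSign i ε)) ^ 2 =
      𝔼 x, ∑ i, (g x - g (flipSign i x)) ^ 2 + 𝔼 x, ∑ i, (h x - h (flipSign i x)) ^ 2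
        + 4 * 𝔼 x, h x ^ 2 := by
  rw [expect_cons, mul_expect, ← expect_add_distrib, ← expect_add_distrib]
  refine expect_congr rfl fun x _ => ?_
  simp only [Fin.sum_univ_succ, flipSign_zero_cons, flipSign_succ_cons, neg_neg]
  have : ∀ a b c d : ℝ, (a + b + (c + d)) / 2 = (b + d) / 2 + (a + c) / 2 := by intros; ring
  rw [this, ← sum_add_distrib, sum_div, ← sum_add_distrib]
  congr 1
  · refine sum_congr rfl fun i _ => ?_
    rw [hg, hg, hh, hh]; ring
  · rw [hh]; ring

theorem expect_sq_cons {n : ℕ} (f : (Fin (n + 1) → ℤˣ) → ℝ) (g h : (Fin n → ℤˣ) → ℝ)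
    (hg : ∀ x, g x = (f (Fin.cons 1 x) + f (Fin.cons (-1) x)) / 2)
    (hh : ∀ x, h x = (f (Fin.cons 1 x) - f (Fin.cons (-1) x)) / 2) :
    𝔼 ε, f ε ^ 2 = 𝔼 x, g x ^ 2 + 𝔼 x, h x ^ 2 := by
  rw [expect_cons, ← expect_add_distrib]
  refine expect_congr rfl fun x _ => ?_
  rw [hg, hh]; ring

/-- The Poincaré inequality on the discrete cube. -/
theorem poincare_cube {n : ℕ} (f : (Fin n → ℤˣ) → ℝ) :
    4 * (𝔼 ε, f ε ^ 2 - (𝔼 ε, f ε) ^ 2) ≤ 𝔼 ε, ∑ i, (f ε - f (flipSign i ε)) ^ 2 := by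
  induction n with
  | zero => simp
  | succ n ih =>
    let g : (Fin n → ℤˣ) → ℝ := fun x => (f (Fin.cons 1 x) + f (Fin.cons (-1) x)) / 2
    let h : (Fin n → ℤˣ) → ℝ := fun x => (f (Fin.cons 1 x) - f (Fin.cons (-1) x)) / 2
    rw [expect_energy_cons f g h (fun _ => rfl) (fun _ => rfl),
      expect_sq_cons f g h (fun _ => rfl) (fun _ => rfl), expect_cons]
    have h1 := ih g
    have h2 : 0 ≤ 𝔼 x, ∑ i, (h x - h (flipSign i x)) ^ 2 :=
      expect_nonneg fun x _ => sum_nonneg fun i _ => sq_nonneg _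
    change 4 * (_ - (𝔼 x, g x) ^ 2) ≤ _
    linarith

/-- Even functions on the discrete cube have no Fourier coefficients of order one, which doubles
the spectral gap. -/
theorem poincare_cube_of_even {n : ℕ} (f : (Fin n → ℤˣ) → ℝ) (hf : ∀ ε, f (-ε) = f ε) :
    8 * (𝔼 ε, f ε ^ 2 - (𝔼 ε, f ε) ^ 2) ≤ 𝔼 ε, ∑ i, (f ε - f (flipSign i ε)) ^ 2 := by
  induction n with
  | zero => simp
  | succ n ih =>
    let g : (Fin n → ℤˣ) → ℝ := fun x => (f (Fin.cons 1 x) + f (Fin.cons (-1) x)) / 2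
    let h : (Fin n → ℤˣ) → ℝ := fun x => (f (Fin.cons 1 x) - f (Fin.cons (-1) x)) / 2
    rw [expect_energy_cons f g h (fun _ => rfl) (fun _ => rfl),
      expect_sq_cons f g h (fun _ => rfl) (fun _ => rfl), expect_cons]
    have e1 : ∀ x : Fin n → ℤˣ, f (Fin.cons 1 (-x)) = f (Fin.cons (-1) x) := fun x => by
      rw [← hf, neg_cons, neg_neg]
    have e2 : ∀ x : Fin n → ℤˣ, f (Fin.cons (-1) (-x)) = f (Fin.cons 1 x) := fun x => by
      rw [← hf, neg_cons, neg_neg, neg_neg]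
    have h1 := ih g fun x => by simp only [g, e1, e2]; ring
    -- An odd `h` has mean zero, so its own energy is at least `4 * 𝔼 h ^ 2`; the first coordinate
    -- supplies as much again, for a total of `8`.
    have hodd : ∀ x, h (-x) = -h x := fun x => by simp only [h, e1, e2]; ring
    have hmean : 𝔼 x, h x = 0 := by
      have := expect_neg h
      simp only [hodd, expect_neg_distrib] at this
      linarith
    have h2 := poincare_cube h
    rw [hmean] at h2
    change 8 * (_ - (𝔼 x, g x) ^ 2) ≤ _
    linarith

/-! ### Kahane–Khinchine inequality for vector sums -/

variable {V : Type*} [NormedAddCommGroup V] [NormedSpace ℝ V]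

/-- The signed sum `∑ i, ε i • v i`. -/
def signSum {ι : Type*} [Fintype ι] (v : ι → V) (ε : ι → ℤˣ) : V :=
  ∑ i, ((ε i : ℤ) : ℝ) • v i

theorem signSum_neg {ι : Type*} [Fintype ι] (v : ι → V) (ε : ι → ℤˣ) :
    signSum v (-ε) = -signSum v ε := by
  simp [signSum]

theorem signSum_flipSign {ι : Type*} [Fintype ι] [DecidableEq ι] (v : ι → V) (ε : ι → ℤˣ)
    (i : ι) : signSum v (flipSign i ε) = signSum v ε - (2 : ℝ) • ((ε i : ℤ) : ℝ) • v i := by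
  rw [signSum, signSum, eq_sub_iff_add_eq, add_comm, ← eq_sub_iff_add_eq, ← sum_sub_distrib,
    sum_eq_single i]
  · simp only [flipSign, Function.update_self, Units.val_neg, Int.cast_neg]
    module
  · intro j _ hj
    simp [flipSign, hj]
  · simp

theorem norm_sign_smul (u : ℤˣ) (v : V) : ‖((u : ℤ) : ℝ) • v‖ = ‖v‖ := by
  rcases Int.units_eq_one_or u with rfl | rfl <;> simp

/-- The Kahane–Khinchine inequality between the first and second moments, with the optimal
constant. -/
theorem expect_sq_norm_signSum_le {n : ℕ} (v : Fin n → V) :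
    𝔼 ε, ‖signSum v ε‖ ^ 2 ≤ 2 * (𝔼 ε, ‖signSum v ε‖) ^ 2 := by
  set f : (Fin n → ℤˣ) → ℝ := fun ε => ‖signSum v ε‖ with hfdef
  have hgap := poincare_cube_of_even f fun ε => by simp [hfdef, signSum_neg]
  have hLap : ∀ ε, ∑ i, (f ε - f (flipSign i ε)) ≤ 2 * f ε := by
    intro ε
    -- Flip `i` subtracts `2 ε i • v i`, so all flips together subtract twice the signed sum. The
    -- triangle inequality then bounds the discrete Laplacian of the norm by `2 * f`; the energy is
    -- at most `4 * 𝔼 f ^ 2`, against the gap `8`.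
    have key : (n : ℝ) • signSum v ε
        = ∑ i, signSum v (flipSign i ε) + (2 : ℝ) • signSum v ε := by
      simp only [signSum_flipSign, sum_sub_distrib, ← smul_sum]
      rw [← signSum]
      simp [Nat.cast_smul_eq_nsmul]
    have h1 : (n : ℝ) * f ε ≤ ∑ i, f (flipSign i ε) + 2 * f ε := by
      calc (n : ℝ) * f ε = ‖(n : ℝ) • signSum v ε‖ := by simp [norm_smul, hfdef]
        _ ≤ ‖∑ i, signSum v (flipSign i ε)‖ + ‖(2 : ℝ) • signSum v ε‖ := by
          rw [key]; exact norm_add_le _ _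
        _ ≤ _ := by
          rw [norm_smul]
          gcongr
          · exact norm_sum_le _ _
          · simp
    rw [sum_sub_distrib]
    simp only [sum_const, card_univ, Fintype.card_fin, nsmul_eq_mul]
    linarith
  have hen : 𝔼 ε, ∑ i, (f ε - f (flipSign i ε)) ^ 2
      = 2 * 𝔼 ε, f ε * ∑ i, (f ε - f (flipSign i ε)) := by
    simp only [mul_sum, mul_expect]
    rw [expect_sum_comm, expect_sum_comm]
    refine sum_congr rfl fun i _ => ?_
    have e : 𝔼 ε, f (flipSign i ε) ^ 2 = 𝔼 ε, f ε ^ 2 := expect_flipSign i fun ε => f ε ^ 2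
    have : ∀ ε, (f ε - f (flipSign i ε)) ^ 2
        = 2 * (f ε * (f ε - f (flipSign i ε))) + (f (flipSign i ε) ^ 2 - f ε ^ 2) := by
      intro ε; ring
    simp only [this]
    rw [expect_add_distrib, expect_sub_distrib, e, sub_self, add_zero]
  have hle : 𝔼 ε, f ε * ∑ i, (f ε - f (flipSign i ε)) ≤ 𝔼 ε, 2 * f ε ^ 2 := by
    refine expect_le_expect fun ε _ => ?_
    have := mul_le_mul_of_nonneg_left (hLap ε) (norm_nonneg (signSum v ε))
    nlinarith [this]
  rw [← mul_expect] at hle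
  linarith

theorem norm_le_expect_norm_signSum {n : ℕ} (v : Fin n → V) (i : Fin n) :
    ‖v i‖ ≤ 𝔼 ε, ‖signSum v ε‖ := by
  have h : 𝔼 ε, (‖signSum v ε‖ + ‖signSum v (flipSign i ε)‖) / 2 = 𝔼 ε, ‖signSum v ε‖ := by
    rw [← expect_div, expect_add_distrib, expect_flipSign i fun ε => ‖signSum v ε‖]
    ring
  rw [← h]
  refine le_expect univ_nonempty fun ε _ => ?_
  have : ‖(2 : ℝ) • ((ε i : ℤ) : ℝ) • v i‖ ≤ ‖signSum v ε‖ + ‖signSum v (flipSign i ε)‖ := by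
    rw [signSum_flipSign]
    calc _ = ‖signSum v ε - (signSum v ε - (2 : ℝ) • ((ε i : ℤ) : ℝ) • v i)‖ := by
          rw [sub_sub_cancel]
      _ ≤ _ := norm_sub_le _ _
  rw [norm_smul, norm_sign_smul] at this
  simp only [Real.norm_ofNat] at this
  linarith

theorem signSum_cons {n : ℕ} (v : Fin (n + 1) → V) (u : ℤˣ) (x : Fin n → ℤˣ) :
    signSum v (Fin.cons u x : Fin (n + 1) → ℤˣ)
      = ((u : ℤ) : ℝ) • v 0 + signSum (fun i => v i.succ) x := by
  simp [signSum, Fin.sum_univ_succ]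

theorem expect_sq_norm_signSum (𝕜 : Type*) [RCLike 𝕜] {W : Type*} [NormedAddCommGroup W]
    [InnerProductSpace 𝕜 W] [NormedSpace ℝ W] {n : ℕ} (v : Fin n → W) :
    𝔼 ε, ‖signSum v ε‖ ^ 2 = ∑ i, ‖v i‖ ^ 2 := by
  induction n with
  | zero => simp [signSum]
  | succ n ih =>
    rw [expect_cons, Fin.sum_univ_succ, ← ih fun i => v i.succ]
    have : ∀ x : Fin n → ℤˣ, (‖signSum v (Fin.cons 1 x : Fin (n + 1) → ℤˣ)‖ ^ 2
        + ‖signSum v (Fin.cons (-1) x : Fin (n + 1) → ℤˣ)‖ ^ 2) / 2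
        = ‖v 0‖ ^ 2 + ‖signSum (fun i => v i.succ) x‖ ^ 2 := by
      intro x
      have := parallelogram_law_with_norm 𝕜 (signSum (fun i => v i.succ) x) (v 0)
      simp only [signSum_cons, Units.val_one, Int.cast_one, one_smul, Units.val_neg, Int.cast_neg,
        neg_smul]
      rw [add_comm (v 0), neg_add_eq_sub]
      linarith
    simp only [this]
    rw [expect_add_distrib, expect_const univ_nonempty]

end SignAverages

/-! ### Signed sums over several slots -/

section TensorSigns

open Finset
open scoped BigOperators

variable {V : Type*} [NormedAddCommGroup V] [NormedSpace ℝ V]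

/-- The signed sum of an array with respect to the product of the sign vectors `ε l`. -/
def tensorSignSum {N n : ℕ} (c : (Fin N → Fin n) → V) (ε : Fin N → Fin n → ℤˣ) : V :=
  ∑ j, (((∏ l, ε l (j l) : ℤˣ) : ℤ) : ℝ) • c j

theorem tensorSignSum_cons {N n : ℕ} (c : (Fin (N + 1) → Fin n) → V) (e : Fin n → ℤˣ)
    (ε : Fin N → Fin n → ℤˣ) :
    tensorSignSum c (Fin.cons e ε : Fin (N + 1) → Fin n → ℤˣ)
      = tensorSignSum (fun j => signSum (fun a => c (Fin.cons a j)) e) ε := by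
  unfold tensorSignSum
  rw [← (Fin.consEquiv fun _ => Fin n).sum_comp, Fintype.sum_prod_type, sum_comm]
  refine sum_congr rfl fun j _ => ?_
  simp only [signSum, smul_sum]
  refine sum_congr rfl fun a _ => ?_
  simp [Fin.consEquiv, Fin.prod_univ_succ, smul_smul, mul_comm]

theorem expect_tensor_cons {N : ℕ} {X : Type*} [Fintype X] (F : (Fin (N + 1) → X) → ℝ) :
    𝔼 ε, F ε = 𝔼 e : X, 𝔼 ε : Fin N → X, F (Fin.cons e ε) := by
  rw [← Fintype.expect_equiv (Fin.consEquiv fun _ => X) (fun q => F (Fin.cons q.1 q.2)) F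
    (fun _ => rfl), ← univ_product_univ, expect_product]

theorem norm_le_expect_norm_tensorSignSum {N n : ℕ} (c : (Fin N → Fin n) → V)
    (j : Fin N → Fin n) : ‖c j‖ ≤ 𝔼 ε, ‖tensorSignSum c ε‖ := by
  induction N with
  | zero => simp [tensorSignSum, Subsingleton.elim j default]
  | succ N ih =>
    rw [expect_tensor_cons]
    simp only [tensorSignSum_cons]
    calc ‖c j‖ = ‖c (Fin.cons (j 0) (Fin.tail j))‖ := by rw [Fin.cons_self_tail]
      _ ≤ 𝔼 e, ‖signSum (fun a => c (Fin.cons a (Fin.tail j))) e‖ :=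
        norm_le_expect_norm_signSum (fun a => c (Fin.cons a (Fin.tail j))) (j 0)
      _ ≤ _ := expect_le_expect fun e _ =>
        ih (fun j => signSum (fun a => c (Fin.cons a j)) e) (Fin.tail j)

/-- Peeling off a slot costs one factor `2`: the slices form vectors in a Hilbert space, where the
vector-valued inequality applies, and the induction hypothesis handles each signed combination of
slices. -/
theorem sum_sq_le_expect_norm_tensorSignSum {𝕜 : Type*} [RCLike 𝕜] {N n : ℕ}
    (c : (Fin N → Fin n) → 𝕜) :
    ∑ j, ‖c j‖ ^ 2 ≤ 2 ^ N * (𝔼 ε, ‖tensorSignSum c ε‖) ^ 2 := by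
  induction N with
  | zero => simp [tensorSignSum]
  | succ N ih =>
    let w : Fin n → EuclideanSpace 𝕜 (Fin N → Fin n) :=
      fun a => WithLp.toLp 2 fun j => c (Fin.cons a j)
    have hw : ∀ e j, signSum w e j = signSum (fun a => c (Fin.cons a j)) e := by
      intro e j
      simp [signSum, w]
    have hnorm : ∀ e, ‖signSum w e‖ ≤ √(2 ^ N) * 𝔼 ε,
        ‖tensorSignSum (fun j => signSum (fun a => c (Fin.cons a j)) e) ε‖ := by
      intro e
      have hnn : 0 ≤ 𝔼 ε,
        ‖tensorSignSum (fun j => signSum (fun a => c (Fin.cons a j)) e) ε‖ :=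
        expect_nonneg fun _ _ => norm_nonneg _
      refine (sq_le_sq₀ (norm_nonneg _) (by positivity)).1 ?_
      rw [mul_pow, Real.sq_sqrt (by positivity), EuclideanSpace.norm_sq_eq]
      simp only [hw]
      exact ih _
    have hsum : ∑ j, ‖c j‖ ^ 2 = ∑ a, ‖w a‖ ^ 2 := by
      rw [← (Fin.consEquiv fun _ => Fin n).sum_comp, Fintype.sum_prod_type]
      refine sum_congr rfl fun a _ => ?_
      rw [EuclideanSpace.norm_sq_eq]
      rfl
    rw [hsum, ← expect_sq_norm_signSum 𝕜 w]
    refine (expect_sq_norm_signSum_le w).trans ?_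
    have hE : 𝔼 e, ‖signSum w e‖ ≤ √(2 ^ N) * 𝔼 ε, ‖tensorSignSum c ε‖ := by
      rw [expect_tensor_cons, mul_expect]
      simp only [tensorSignSum_cons]
      exact expect_le_expect fun e _ => hnorm e
    calc 2 * (𝔼 e, ‖signSum w e‖) ^ 2
        ≤ 2 * (√(2 ^ N) * 𝔼 ε, ‖tensorSignSum c ε‖) ^ 2 := by
          have : 0 ≤ 𝔼 e, ‖signSum w e‖ := expect_nonneg fun _ _ => norm_nonneg _
          gcongr
      _ = _ := by rw [mul_pow, Real.sq_sqrt (by positivity)]; ring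

/-- For `s ≥ 2` the `ℓ_s` norm of an array is controlled by the first moment of its signed
sums. -/
theorem rpow_sum_rpow_le_expect_norm_tensorSignSum {𝕜 : Type*} [RCLike 𝕜] {N n : ℕ} {s : ℝ}
    (hs : 2 ≤ s) (c : (Fin N → Fin n) → 𝕜) :
    (∑ j, ‖c j‖ ^ s) ^ (1 / s) ≤ 2 ^ ((N : ℝ) / s) * 𝔼 ε, ‖tensorSignSum c ε‖ := by
  set E := 𝔼 ε, ‖tensorSignSum c ε‖ with hE
  have hE0 : 0 ≤ E := expect_nonneg fun _ _ => norm_nonneg _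
  have hs0 : 0 < s := by linarith
  have hsplit : ∀ x : ℝ, 0 ≤ x → x ^ s = x ^ (s - 2) * x ^ 2 := by
    intro x hx
    rw [← Real.rpow_natCast x 2, ← Real.rpow_add_of_nonneg hx (by linarith) (by norm_num)]
    norm_num
  have h1 : ∑ j, ‖c j‖ ^ s ≤ 2 ^ (N : ℝ) * E ^ s := by
    -- Interpolation between `ℓ_∞` (constant `1`) and `ℓ_2` (constant `2 ^ (N / 2)`).
    calc ∑ j, ‖c j‖ ^ s ≤ ∑ j, E ^ (s - 2) * ‖c j‖ ^ 2 := by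
          refine sum_le_sum fun j _ => ?_
          rw [hsplit _ (norm_nonneg _)]
          gcongr
          exact norm_le_expect_norm_tensorSignSum c j
      _ = E ^ (s - 2) * ∑ j, ‖c j‖ ^ 2 := by rw [mul_sum]
      _ ≤ E ^ (s - 2) * (2 ^ N * E ^ 2) := by
          gcongr
          exact sum_sq_le_expect_norm_tensorSignSum c
      _ = _ := by rw [hsplit E hE0, Real.rpow_natCast]; ring
  calc (∑ j, ‖c j‖ ^ s) ^ (1 / s) ≤ (2 ^ (N : ℝ) * E ^ s) ^ (1 / s) := by gcongr
    _ = _ := by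
      rw [Real.mul_rpow (by positivity) (by positivity), ← Real.rpow_mul (by norm_num),
        ← Real.rpow_mul hE0, mul_one_div, mul_one_div, div_self hs0.ne', Real.rpow_one]

end TensorSigns

/-! ### Mixed norms under diagonal weights -/

section MixedNorms

open Finset
open scoped BigOperators

theorem sum_filter_eq_sum_insertNth {M : Type*} [AddCommMonoid M] {N n : ℕ} (k : Fin (N + 1))
    (a : Fin n) (F : (Fin (N + 1) → Fin n) → M) :
    ∑ j with j k = a, F j = ∑ j : Fin N → Fin n, F (k.insertNth a j) := by
  rw [sum_filter, ← (Fin.insertNthEquiv (fun _ => Fin n) k).sum_comp, Fintype.sum_prod_type,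
    sum_eq_single a]
  · simp [Fin.insertNthEquiv]
  · intro b _ hb
    simp [Fin.insertNthEquiv, hb]
  · simp

/-- Let `A` be the coefficient array of a form of norm at most `K` on a product of `ℓ_p` spaces.
After a diagonal change of variables in every slot, the `ℓ_1(ℓ_s)` norm of the array is at most
`2 ^ (N / s) * K` for every `s ≥ 2`. -/
theorem sum_rpow_sum_weighted_le {𝕜 : Type*} [RCLike 𝕜] {N n : ℕ} {p s K : ℝ} (hs : 2 ≤ s)
    (A : (Fin (N + 1) → Fin n) → 𝕜)
    (hA : ∀ y : Fin (N + 1) → Fin n → 𝕜, (∀ l, ∑ t, ‖y l t‖ ^ p ≤ 1) →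
      ‖∑ j, (∏ l, y l (j l)) * A j‖ ≤ K)
    (k : Fin (N + 1)) (x : Fin (N + 1) → Fin n → ℝ) (hx0 : ∀ l t, 0 ≤ x l t)
    (hx : ∀ l, ∑ t, x l t ^ p ≤ 1) :
    ∑ a, (∑ j with j k = a, ‖A j‖ ^ s * ∏ l, x l (j l) ^ s) ^ (1 / s)
      ≤ 2 ^ ((N : ℝ) / s) * K := by
  let b : Fin n → (Fin N → Fin n) → 𝕜 := fun a j =>
    ((∏ l, x l ((k.insertNth a j : Fin (N + 1) → Fin n) l) : ℝ) : 𝕜) * A (k.insertNth a j)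
  have hb : ∀ a j, ‖b a j‖ ^ s = ‖A (k.insertNth a j)‖ ^ s
      * ∏ l, x l ((k.insertNth a j : Fin (N + 1) → Fin n) l) ^ s := by
    intro a j
    have h0 : 0 ≤ ∏ l, x l ((k.insertNth a j : Fin (N + 1) → Fin n) l) := prod_nonneg fun l _ => hx0 _ _
    rw [norm_mul, RCLike.norm_ofReal, abs_of_nonneg h0, Real.mul_rpow h0 (norm_nonneg _),
      ← Real.finsetProd_rpow _ _ (fun l _ => hx0 _ _), mul_comm]
  have hsign : ∀ ε : Fin N → Fin n → ℤˣ, ∑ a, ‖tensorSignSum (b a) ε‖ ≤ K := by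
    intro ε
    -- The phases `η` make every slot `k` term nonnegative, so the form at `y` equals the whole sum
    -- of norms, while `‖y l t‖` stays `x l t`.
    choose η hη1 hη using fun a => RCLike.exists_norm_eq_mul_self (tensorSignSum (b a) ε)
    let y : Fin (N + 1) → Fin n → 𝕜 := k.insertNth (fun t => η t * (x k t : 𝕜))
      fun l t => (((ε l t : ℤ) : ℝ) : 𝕜) * (x (k.succAbove l) t : 𝕜)
    have hy : ∀ l t, ‖y l t‖ = x l t := by
      intro l t
      refine Fin.succAboveCases k ?_ (fun l => ?_) l
      · simp [y, hη1, abs_of_nonneg (hx0 _ _)]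
      · rcases Int.units_eq_one_or (ε l t) with h | h <;> simp [y, h, abs_of_nonneg (hx0 _ _)]
    have hyA := hA y fun l => by simpa only [hy] using hx l
    have hexp : ∑ j, (∏ l, y l (j l)) * A j = ((∑ a, ‖tensorSignSum (b a) ε‖ : ℝ) : 𝕜) := by
      rw [← (Fin.insertNthEquiv (fun _ => Fin n) k).sum_comp, Fintype.sum_prod_type,
        RCLike.ofReal_sum]
      refine sum_congr rfl fun a _ => ?_
      rw [hη, tensorSignSum, mul_sum]
      refine sum_congr rfl fun j _ => ?_
      simp only [Fin.insertNthEquiv, Equiv.coe_fn_mk, b, Fin.prod_univ_succAbove _ k, y,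
        Fin.insertNth_apply_same, Fin.insertNth_apply_succAbove, prod_mul_distrib,
        RCLike.real_smul_eq_coe_mul]
      push_cast
      ring
    rw [hexp, RCLike.norm_ofReal] at hyA
    exact (le_abs_self _).trans hyA
  calc ∑ a, (∑ j with j k = a, ‖A j‖ ^ s * ∏ l, x l (j l) ^ s) ^ (1 / s)
      = ∑ a, (∑ j, ‖b a j‖ ^ s) ^ (1 / s) := by
        refine sum_congr rfl fun a _ => ?_
        rw [sum_filter_eq_sum_insertNth]
        simp only [hb]
    _ ≤ ∑ a, 2 ^ ((N : ℝ) / s) * 𝔼 ε, ‖tensorSignSum (b a) ε‖ :=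
        sum_le_sum fun a _ => rpow_sum_rpow_le_expect_norm_tensorSignSum hs (b a)
    _ = 2 ^ ((N : ℝ) / s) * 𝔼 ε, ∑ a, ‖tensorSignSum (b a) ε‖ := by
        rw [← mul_sum, expect_sum_comm]
    _ ≤ _ := by
        gcongr
        exact expect_le univ_nonempty fun ε _ => hsign ε

/-- For a probability array `q` on a product of `N + 1` finite sets, damping `q` by powers of its
marginals in all slots but `i` leaves some mixed `ℓ_1(ℓ_s)` norm at least one. -/
theorem exists_one_le_sum_rpow_sum_mul_marginals {κ ι : Type*} [Fintype κ] [DecidableEq κ]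
    [Fintype ι] [DecidableEq ι] {N p : ℝ} (hN : 0 < N) (hcard : (Fintype.card κ : ℝ) = N + 1)
    (hNp : N < p) (q : (κ → ι) → ℝ) (hq : ∀ j, 0 ≤ q j) (hq1 : ∑ j, q j = 1)
    (M : κ → ι → ℝ) (hM : ∀ k a, M k a = ∑ j with j k = a, q j) (i : κ) :
    ∃ k, 1 ≤ ∑ a, (∑ j with j k = a,
      q j * ∏ l ∈ univ.erase i, M l (j l) ^ (1 / (p - N))) ^ ((p - N) / p) := by
  have hp : 0 < p := hN.trans hNp
  have hd : 0 < p - N := sub_pos.2 hNp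
  have hM0 : ∀ k a, 0 ≤ M k a := fun k a => by
    rw [hM]; exact sum_nonneg fun j _ => hq j
  have hqM : ∀ k j, q j ≤ M k (j k) := fun k j => by
    rw [hM]
    exact single_le_sum (f := q) (fun j _ => hq j) (by simp)
  have : Nonempty κ := ⟨i⟩
  have hS : ((univ.erase i).card : ℝ) = N := by
    rw [card_erase_of_mem (mem_univ i), card_univ, Nat.cast_sub Fintype.card_pos, hcard]
    simp
  -- Hölder on the fibre over `a`, of mass `M k a`, yields a factor `M k a ^ (N / p)`, which the
  -- negative power cancels.
  have hjensen : ∀ k, ∑ j, q j * (M k (j k) ^ (-(N / p))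
        * ∏ l ∈ univ.erase i, M l (j l) ^ (1 / p))
      ≤ ∑ a, (∑ j with j k = a,
        q j * ∏ l ∈ univ.erase i, M l (j l) ^ (1 / (p - N))) ^ ((p - N) / p) := by
    intro k
    rw [← sum_fiberwise univ (fun j : κ → ι => j k)]
    refine sum_le_sum fun a _ => ?_
    have hH := Real.inner_le_weight_mul_Lp_of_nonneg (univ.filter fun j : κ → ι => j k = a)
      (p := p / (p - N)) (by rw [le_div_iff₀ hd]; linarith) q
      (fun j => ∏ l ∈ univ.erase i, M l (j l) ^ (1 / p)) (fun j => hq j)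
      (fun j => prod_nonneg fun l _ => Real.rpow_nonneg (hM0 _ _) _)
    have e1 : ∀ j : κ → ι, (∏ l ∈ univ.erase i, M l (j l) ^ (1 / p)) ^ (p / (p - N))
        = ∏ l ∈ univ.erase i, M l (j l) ^ (1 / (p - N)) := by
      intro j
      rw [← Real.finsetProd_rpow _ _ (fun l _ => Real.rpow_nonneg (hM0 _ _) _)]
      refine prod_congr rfl fun l _ => ?_
      rw [← Real.rpow_mul (hM0 _ _)]
      congr 1
      field_simp
    have e2 : 1 - (p / (p - N))⁻¹ = N / p := by field_simp; ring
    simp only [e1] at hH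
    rw [e2, inv_div, ← hM] at hH
    have e3 : ∑ j with j k = a, q j * (M k (j k) ^ (-(N / p))
        * ∏ l ∈ univ.erase i, M l (j l) ^ (1 / p))
        = M k a ^ (-(N / p)) * ∑ j with j k = a, q j
          * ∏ l ∈ univ.erase i, M l (j l) ^ (1 / p) := by
      rw [mul_sum]
      refine sum_congr rfl fun j hj => ?_
      rw [(mem_filter.1 hj).2]; ring
    rw [e3]
    have hG : 0 ≤ (∑ j with j k = a,
        q j * ∏ l ∈ univ.erase i, M l (j l) ^ (1 / (p - N))) ^ ((p - N) / p) :=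
      Real.rpow_nonneg (sum_nonneg fun j _ => mul_nonneg (hq j)
        (prod_nonneg fun l _ => Real.rpow_nonneg (hM0 _ _) _)) _
    rcases (hM0 k a).eq_or_lt with h0 | h0
    -- On a null fibre the negative power of `0` is `0` by convention.
    · rw [← h0, Real.zero_rpow (by have := div_pos hN hp; linarith), zero_mul]
      exact hG
    · calc _ ≤ M k a ^ (-(N / p)) * _ :=
            mul_le_mul_of_nonneg_left hH (Real.rpow_nonneg (hM0 _ _) _)
        _ = _ := by
          rw [← mul_assoc, ← Real.rpow_add h0, neg_add_cancel, Real.rpow_zero, one_mul]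
  -- With weights `1 / N`, the geometric mean of `M k (j k) ^ (-(N / p))` over `k ≠ i` is exactly
  -- the inverse of the damping product.
  have hamgm : ∀ j, q j ≤ ∑ k ∈ univ.erase i, (1 / N) * (q j * (M k (j k) ^ (-(N / p))
        * ∏ l ∈ univ.erase i, M l (j l) ^ (1 / p))) := by
    intro j
    rcases (hq j).eq_or_lt with h0 | h0
    · simp [← h0]
    have hpos : ∀ k, 0 < M k (j k) := fun k => h0.trans_le (hqM k j)
    have h := Real.geom_mean_le_arith_mean_weighted (univ.erase i) (fun _ => 1 / N)
      (fun k => M k (j k) ^ (-(N / p))) (fun _ _ => by positivity)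
      (by rw [sum_const, nsmul_eq_mul, hS]; field_simp)
      (fun k _ => Real.rpow_nonneg (hM0 _ _) _)
    have hP : 0 < ∏ l ∈ univ.erase i, M l (j l) ^ (1 / p) :=
      prod_pos fun l _ => Real.rpow_pos_of_pos (hpos l) _
    have e : ∏ k ∈ univ.erase i, (M k (j k) ^ (-(N / p))) ^ (1 / N)
        = (∏ l ∈ univ.erase i, M l (j l) ^ (1 / p))⁻¹ := by
      rw [← prod_inv_distrib]
      refine prod_congr rfl fun k _ => ?_
      rw [← Real.rpow_mul (hM0 _ _), ← Real.rpow_neg (hM0 _ _)]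
      congr 1
      field_simp
    rw [e] at h
    calc q j = q j * (∏ l ∈ univ.erase i, M l (j l) ^ (1 / p))
          * (∏ l ∈ univ.erase i, M l (j l) ^ (1 / p))⁻¹ := by
          rw [mul_assoc, mul_inv_cancel₀ hP.ne', mul_one]
      _ ≤ q j * (∏ l ∈ univ.erase i, M l (j l) ^ (1 / p))
          * ∑ k ∈ univ.erase i, 1 / N * M k (j k) ^ (-(N / p)) := by gcongr
      _ = _ := by
          rw [mul_sum]
          exact sum_congr rfl fun k _ => by ring
  have hne : (univ.erase i).Nonempty := by
    rw [← card_pos]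
    exact_mod_cast hS ▸ hN
  obtain ⟨k, -, hk⟩ := exists_le_of_sum_le hne
    (f := fun _ => (1 : ℝ)) (g := fun k => ∑ j, q j * (M k (j k) ^ (-(N / p))
        * ∏ l ∈ univ.erase i, M l (j l) ^ (1 / p))) (by
      rw [sum_const, nsmul_eq_mul, hS, mul_one]
      have := sum_le_sum fun j (_ : j ∈ univ) => hamgm j
      rw [hq1, sum_comm] at this
      simp only [← mul_sum] at this ⊢
      rwa [one_div_mul_eq_div, le_div_iff₀ hN, one_mul] at this)
  exact ⟨k, hk.trans (hjensen k)⟩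

/-- If all `ℓ_1(ℓ_s)` norms of the array `c ^ (1 / s)` stay bounded by `K` under diagonal changes
of variables from the unit ball of `ℓ_p`, then its `ℓ_r(ℓ_s)` norms are bounded by `K`, where
`1 / s = 1 - N / p` and `1 / r = 1 - (N + 1) / p`. -/
theorem rpow_sum_rpow_le_of_weighted {κ ι : Type*} [Fintype κ] [DecidableEq κ]
    [Fintype ι] [DecidableEq ι] {N p K : ℝ} (hN : 0 < N)
    (hcard : (Fintype.card κ : ℝ) = N + 1) (hNp : N + 1 < p) (c : (κ → ι) → ℝ)
    (hc : ∀ j, 0 ≤ c j)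
    (hK : ∀ k, ∀ x : κ → ι → ℝ, (∀ l t, 0 ≤ x l t) → (∀ l, ∑ t, x l t ^ p ≤ 1) →
      ∑ a, (∑ j with j k = a, c j * ∏ l, x l (j l) ^ (p / (p - N))) ^ ((p - N) / p) ≤ K)
    (i : κ) :
    (∑ a, (∑ j with j i = a, c j) ^ ((p - N) / (p - (N + 1)))) ^ ((p - (N + 1)) / p) ≤ K := by
  have hd1 : 0 < p - (N + 1) := sub_pos.2 hNp
  have hd : 0 < p - N := by linarith
  have hp : 0 < p := by linarith
  set m : ι → ℝ := fun a => ∑ j with j i = a, c j with hm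
  have hm0 : ∀ a, 0 ≤ m a := fun a => sum_nonneg fun j _ => hc j
  set ρ := (p - N) / (p - (N + 1)) with hρ
  have hρ0 : 0 < ρ := div_pos hd hd1
  set Q := ∑ a, m a ^ ρ with hQ
  have hQ0 : 0 ≤ Q := sum_nonneg fun a _ => Real.rpow_nonneg (hm0 a) _
  rcases hQ0.eq_or_lt with h0 | hQpos
  · rw [← h0, Real.zero_rpow (div_pos hd1 hp).ne']
    -- The zero weights show `0 ≤ K`.
    refine le_trans ?_ (hK i (fun _ _ => 0) (fun _ _ => le_rfl) fun l => by
      simp [Real.zero_rpow hp.ne'])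
    exact sum_nonneg fun a _ => Real.rpow_nonneg (sum_nonneg fun j _ => mul_nonneg (hc j)
      (prod_nonneg fun l _ => Real.rpow_nonneg le_rfl _)) _
  set Z := Q ^ ((p - (N + 1)) / (p - N)) with hZ
  have hZpos : 0 < Z := Real.rpow_pos_of_pos hQpos _
  -- The marginal of `q` in slot `i` must be `u` itself: `m * u ^ (1 / (p - N)) = Z * u` forces `u`
  -- proportional to `m ^ ρ`, and `Z` normalizes.
  set u : ι → ℝ := fun a => m a ^ ρ / Q with hu
  have hu0 : ∀ a, 0 ≤ u a := fun a => div_nonneg (Real.rpow_nonneg (hm0 a) _) hQ0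
  set q : (κ → ι) → ℝ := fun j => c j * u (j i) ^ (1 / (p - N)) / Z with hq
  have hq0 : ∀ j, 0 ≤ q j := fun j =>
    div_nonneg (mul_nonneg (hc j) (Real.rpow_nonneg (hu0 _) _)) hZpos.le
  have hmarg : ∀ a, ∑ j with j i = a, q j = u a := by
    intro a
    have e1 : ∑ j with j i = a, q j = m a * u a ^ (1 / (p - N)) / Z := by
      rw [hm, sum_mul, sum_div]
      refine sum_congr rfl fun j hj => ?_
      rw [hq, ← (mem_filter.1 hj).2]
    have e2 : Q ^ (1 / (p - N)) * Z = Q := by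
      rw [hZ, ← Real.rpow_add hQpos]
      conv_rhs => rw [← Real.rpow_one Q]
      congr 1
      field_simp
      ring
    have e3 : m a * (m a ^ ρ) ^ (1 / (p - N)) = m a ^ ρ := by
      rw [← Real.rpow_mul (hm0 a)]
      nth_rw 1 [← Real.rpow_one (m a)]
      rw [← Real.rpow_add_of_nonneg (hm0 a) zero_le_one (by positivity)]
      congr 1
      rw [hρ]
      field_simp
      ring
    rw [e1, hu]
    simp only
    rw [Real.div_rpow (Real.rpow_nonneg (hm0 a) _) hQ0, ← mul_div_assoc, e3, div_div, e2]
  have hq1 : ∑ j, q j = 1 := by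
    rw [← sum_fiberwise univ (fun j : κ → ι => j i)]
    simp only [hmarg]
    rw [hu, ← sum_div, ← hQ, div_self hQpos.ne']
  set M : κ → ι → ℝ := fun k a => ∑ j with j k = a, q j with hM
  have hM0 : ∀ k a, 0 ≤ M k a := fun k a => sum_nonneg fun j _ => hq0 j
  have hM1 : ∀ k, ∑ a, M k a = 1 := fun k => by
    rw [hM, sum_fiberwise univ (fun j : κ → ι => j k), hq1]
  obtain ⟨k, hk⟩ := exists_one_le_sum_rpow_sum_mul_marginals hN hcard
    (show N < p by linarith) q hq0 hq1 M
    (fun _ _ => rfl) i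
  have hx := hK k (fun l a => M l a ^ (1 / p)) (fun l a => Real.rpow_nonneg (hM0 l a) _)
    fun l => by
      refine (Finset.sum_congr rfl fun a _ => ?_).trans_le (hM1 l).le
      rw [← Real.rpow_mul (hM0 l a), one_div_mul_cancel hp.ne', Real.rpow_one]
  -- The slot `i` weight is absorbed into `q`, leaving only the damping by the other marginals.
  have e4 : ∀ j : κ → ι, c j * ∏ l, (M l (j l) ^ (1 / p)) ^ (p / (p - N))
      = Z * (q j * ∏ l ∈ univ.erase i, M l (j l) ^ (1 / (p - N))) := by
    intro j
    have : ∀ l, (M l (j l) ^ (1 / p)) ^ (p / (p - N)) = M l (j l) ^ (1 / (p - N)) := by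
      intro l
      rw [← Real.rpow_mul (hM0 _ _)]
      congr 1
      field_simp
    simp only [this]
    rw [← mul_prod_erase univ _ (mem_univ i), show M i (j i) = u (j i) from hmarg _, hq]
    field_simp
  simp only [e4, ← mul_sum] at hx
  have e5 : Z ^ ((p - N) / p) = Q ^ ((p - (N + 1)) / p) := by
    rw [hZ, ← Real.rpow_mul hQ0]
    congr 1
    field_simp
  have e6 : ∀ a, (Z * ∑ j with j k = a, q j * ∏ l ∈ univ.erase i, M l (j l) ^ (1 / (p - N)))
      ^ ((p - N) / p) = Q ^ ((p - (N + 1)) / p) * (∑ j with j k = a,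
        q j * ∏ l ∈ univ.erase i, M l (j l) ^ (1 / (p - N))) ^ ((p - N) / p) := by
    intro a
    rw [Real.mul_rpow hZpos.le (sum_nonneg fun j _ => mul_nonneg (hq0 j)
      (prod_nonneg fun l _ => Real.rpow_nonneg (hM0 _ _) _)), e5]
  simp only [e6, ← mul_sum] at hx
  exact (le_mul_of_one_le_right (Real.rpow_nonneg hQ0 _) hk).trans hx

end MixedNorms

/-! ### Forms on `ℓ_p` and the final estimate -/

theorem norm_sum_prod_mul_apply_single_le {𝕜 : Type*} [RCLike 𝕜] {κ : Type*} [Fintype κ]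
    [DecidableEq κ] {n : ℕ} {p : ℝ} (hp : 0 < p) [Fact (1 ≤ ENNReal.ofReal p)]
    (T : ContinuousMultilinearMap 𝕜 (fun _ : κ => lp (fun _ : ℕ => 𝕜) (ENNReal.ofReal p)) 𝕜)
    (y : κ → Fin n → 𝕜) (hy : ∀ l, ∑ t, ‖y l t‖ ^ p ≤ 1) :
    ‖∑ j : κ → Fin n, (∏ l, y l (j l)) * T (fun l => lp.single (E := fun _ : ℕ => 𝕜)
      (ENNReal.ofReal p) (j l : ℕ) (1 : 𝕜))‖ ≤ ‖T‖ := by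
  let v : κ → lp (fun _ : ℕ => 𝕜) (ENNReal.ofReal p) := fun l =>
    ∑ t : Fin n, y l t • lp.single (E := fun _ : ℕ => 𝕜) (ENNReal.ofReal p) (t : ℕ) (1 : 𝕜)
  have hT : T v = ∑ j : κ → Fin n, (∏ l, y l (j l)) * T (fun l => lp.single
      (E := fun _ : ℕ => 𝕜) (ENNReal.ofReal p) (j l : ℕ) (1 : 𝕜)) := by
    rw [ContinuousMultilinearMap.map_sum]
    refine Finset.sum_congr rfl fun j _ => ?_
    rw [ContinuousMultilinearMap.map_smul_univ, smul_eq_mul]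
  have htoReal : (ENNReal.ofReal p).toReal = p := ENNReal.toReal_ofReal hp.le
  have hv : ∀ l, ‖v l‖ ≤ 1 := by
    intro l
    let f : ℕ → 𝕜 := fun t => if h : t < n then y l ⟨t, h⟩ else 0
    have hvf : v l = ∑ t ∈ Finset.range n, lp.single (E := fun _ : ℕ => 𝕜)
        (ENNReal.ofReal p) t (f t) := by
      rw [Finset.sum_range]
      refine Finset.sum_congr rfl fun t _ => ?_
      rw [← lp.single_smul]
      simp [f]
    have h := lp.norm_sum_single (E := fun _ : ℕ => 𝕜) (p := ENNReal.ofReal p)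
      (by rwa [htoReal]) f (Finset.range n)
    rw [← hvf, htoReal, Finset.sum_range] at h
    have h1 : ‖v l‖ ^ p ≤ 1 := by
      rw [h]
      simpa [f] using hy l
    by_contra hlt
    exact absurd h1 (not_le.2 (Real.one_lt_rpow (not_le.1 hlt) hp))
  rw [← hT]
  calc ‖T v‖ ≤ ‖T‖ * ∏ l, ‖v l‖ := T.le_opNorm v
    _ ≤ ‖T‖ * 1 := by
      gcongr
      exact Finset.prod_le_one (fun l _ => norm_nonneg _) fun l _ => hv l
    _ = ‖T‖ := mul_one _

theorem theorem3p3 {𝕜 : Type*} [RCLike 𝕜] (m : ℕ) (hm : 2 ≤ m) (p : ℝ)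
    [Fact (1 ≤ ENNReal.ofReal p)] (hmp : (m : ℝ) < p) (hp : p ≤ 2 * (m : ℝ) - 2)
    (T : ContinuousMultilinearMap 𝕜
      (fun _ : Fin m => lp (fun _ : ℕ => 𝕜) (ENNReal.ofReal p)) 𝕜)
    (i : Fin m) (n : ℕ) :
    (∑ k : Fin n,
        (∑ j : Fin m → Fin n with j i = k,
            ‖T (fun l => lp.single (E := fun _ : ℕ => 𝕜) (ENNReal.ofReal p)
              (j l : ℕ) (1 : 𝕜))‖ ^ (p / (p - ((m : ℝ) - 1))))
          ^ ((p - ((m : ℝ) - 1)) / p * (p / (p - (m : ℝ)))))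
        ^ ((p - (m : ℝ)) / p)
      ≤ (2 : ℝ) ^ (((m : ℝ) - 1) * (p - (m : ℝ) + 1) / p) * ‖T‖ := by
  obtain ⟨N, rfl⟩ : ∃ N, m = N + 1 := ⟨m - 1, by omega⟩
  have hN : (0 : ℝ) < N := by
    have : 0 < N := by omega
    exact_mod_cast this
  push_cast at hmp hp ⊢
  have hd : 0 < p - N := by linarith
  have hd1 : 0 < p - (N + 1) := by linarith
  have hp0 : 0 < p := by linarith
  have hs : 2 ≤ p / (p - N) := by
    rw [le_div_iff₀ hd]; linarith
  simp only [add_sub_cancel_right]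
  have e1 : (p - N) / p * (p / (p - (N + 1))) = (p - N) / (p - (N + 1)) := by field_simp
  have e2 : (N : ℝ) * (p - (N + 1) + 1) / p = N / (p / (p - N)) := by
    field_simp
    ring
  rw [e1, e2]
  refine rpow_sum_rpow_le_of_weighted hN (by simp) hmp _
    (fun j => Real.rpow_nonneg (norm_nonneg _) _) (fun k x hx0 hx => ?_) i
  rw [← one_div_div p]
  exact sum_rpow_sum_weighted_le hs _ (norm_sum_prod_mul_apply_single_le hp0 T) k x hx0 hx
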